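/- Let $C_n$ denote the cyclic group of order $n$. A subset $D$ of a finite group $\mathcal{G}$ is a $(v,\kappa,\lambda,\mu)$-partial difference set (PDS) if $|\mathcal{G}|=v$, $|D|=\kappa$, every $g\in D$ can be written as $g=d_1d_2^{-1}$ with $(d_1,d_2)\in D\times D$ in exactly $\lambda$ ways, and every $g\in\mathcal{G}\setminus(D\cup\{1\})$ can be so written in exactly $\mu$ ways. Theorem. Let $t\ge 2$ be an integer. For each integer $k$ with $1\le k\le t$ there exists a nonabelian group \[\mathcal{G}\cong (C_4^t\times C_2^{t-k})\rtimes C_2^k\] (a semidirect product with respect to some action of $C_2^k$ on $C_4^t\times C_2^{t-k}$ by automorphisms) that contains a PDS with Denniston parameters, namely a PDS with parameters \[\left(2^{3t},\ (2^{2t-1}-2^{t-1})(2^t-1),\ 2^{t-1}+(2^{2t-1}-2^{t-1})(2^{t-1}-2),\ (2^{2t-1}-2^{t-1})(2^{t-1}-1)\right).\] -/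

import Mathlib

/-- `D` is a `(v, k, l, m)`-partial difference set in the finite group `G`: `|G| = v`, `|D| = k`,
every `g ∈ D` is `d₁ * d₂⁻¹` for exactly `l` pairs `(d₁, d₂) ∈ D × D`, and every nonidentity
`g ∉ D` is so for exactly `m` pairs. -/
structure IsPartialDifferenceSet {G : Type*} [Group G] (D : Set G) (v k l m : ℕ) : Prop where
  finite : Finite G
  card_group : Nat.card G = v
  card_set : D.ncard = k
  card_mem : ∀ g ∈ D, {p : G × G | p.1 ∈ D ∧ p.2 ∈ D ∧ p.1 * p.2⁻¹ = g}.ncard = l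
  card_notMem : ∀ g ∉ D, g ≠ 1 → {p : G × G | p.1 ∈ D ∧ p.2 ∈ D ∧ p.1 * p.2⁻¹ = g}.ncard = m

/-- `Cpow n r` is `C_n ^ r`, the direct product of `r` copies of the cyclic group of order `n`,
written multiplicatively. -/
abbrev Cpow (n r : ℕ) : Type := Fin r → Multiplicative (ZMod n)

/-! Let `F` have order q = 2^t. On `CarryPair F` ≅ C_4^t take ±1-valued functions f_w (w ≠ 0) with
sum -q, zero autocorrelation off the identity, and cross-correlation of f_w and f_w' equal to -q
f_(w+w') for w ≠ w' (`sum_carryBent`, `sum_carryBent_mul_self`, `sum_carryBent_mul`). Let D be the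
set of (y, w) with w ≠ 0 and f_w(y) = 1. Its difference counts at (y, w) then depend only on f_w(y),
so D is a PDS in the abelian group C_4^t × C_2^t.

D is closed under inversion and C_2^k is its own inverse pointwise, so D is stable under inverting
only the factor A = C_4^t × C_2^(t-k). Letting one generator of C_2^k act on A by inversion changes
the group law only by symmetries of D. The same set is thus a PDS in a nonabelian semidirect
product. -/

/-- Pairs over `R` under addition with carry: `(a, b) * (c, d) = (a + c, b + d + a * c)`.
Over the field of order `2 ^ t` this group is isomorphic to `C_4 ^ t`. -/
@[ext]
structure CarryPair (R : Type*) where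
  /-- the low digit -/
  fst : R
  /-- the high digit -/
  snd : R

/-! ### The group of pairs with carry. -/

namespace CarryPair

section Ring

variable {R : Type*} [CommRing R]

instance : Mul (CarryPair R) := ⟨fun x y => ⟨x.fst + y.fst, x.snd + y.snd + x.fst * y.fst⟩⟩
instance : One (CarryPair R) := ⟨⟨0, 0⟩⟩
instance : Inv (CarryPair R) := ⟨fun x => ⟨-x.fst, -x.snd + x.fst ^ 2⟩⟩

@[simp] theorem fst_mul (x y : CarryPair R) : (x * y).fst = x.fst + y.fst := rfl
@[simp] theorem snd_mul (x y : CarryPair R) :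
    (x * y).snd = x.snd + y.snd + x.fst * y.fst := rfl
@[simp] theorem fst_one : (1 : CarryPair R).fst = 0 := rfl
@[simp] theorem snd_one : (1 : CarryPair R).snd = 0 := rfl
@[simp] theorem fst_inv (x : CarryPair R) : x⁻¹.fst = -x.fst := rfl
@[simp] theorem snd_inv (x : CarryPair R) : x⁻¹.snd = -x.snd + x.fst ^ 2 := rfl

instance : CommGroup (CarryPair R) where
  mul_assoc x y z := by ext <;> simp <;> ring
  one_mul x := by ext <;> simp
  mul_one x := by ext <;> simp
  inv_mul_cancel x := by
    ext <;> simp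
    ring
  mul_comm x y := by ext <;> simp <;> ring

end Ring

/-- The underlying pair. -/
def equivProd (R : Type*) : CarryPair R ≃ R × R where
  toFun x := (x.fst, x.snd)
  invFun x := ⟨x.1, x.2⟩
  left_inv _ := rfl
  right_inv _ := rfl

instance {R : Type*} [Fintype R] : Fintype (CarryPair R) := Fintype.ofEquiv _ (equivProd R).symm

theorem card_eq (R : Type*) : Nat.card (CarryPair R) = Nat.card R ^ 2 := by
  rw [Nat.card_congr (equivProd R), Nat.card_prod, sq]

theorem sum_eq {R M : Type*} [Fintype R] [AddCommMonoid M] (g : CarryPair R → M) :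
    ∑ y, g y = ∑ u, ∑ v, g ⟨u, v⟩ := by
  rw [← Fintype.sum_prod_type', ← (equivProd R).symm.sum_comp]
  rfl

end CarryPair

/-! ### Correlations of the bent family. -/

section BentFamily

variable {F : Type*} [Field F]

/-- A family of functions with values `±1` on `CarryPair F`, indexed by the nonzero `w`. -/
def carryBent (χ : AddChar F ℤ) (δ w : F) (y : CarryPair F) : ℤ :=
  χ (y.fst / w + (y.fst / w) ^ 3 + δ * (y.fst / w) ^ 2 + y.snd * ((y.fst / w + 1) / w) ^ 2)

variable {χ : AddChar F ℤ} {δ : F}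

/-- Orthogonality kills the sum over v unless h u = 0. Every correlation below is linear in the high
digit, so it reduces to the zeros of the coefficient. -/
theorem sum_addChar_mul_add [Fintype F] [DecidableEq F] (hχ : χ ≠ 1) (g : F → F) (h : F → F) :
    ∑ u, ∑ v, χ (g u + v * h u) =
      Fintype.card F * ∑ u, if h u = 0 then χ (g u) else 0 := by
  rw [Finset.mul_sum]
  refine Finset.sum_congr rfl fun u _ => ?_
  simp_rw [AddChar.map_add_eq_mul, ← Finset.mul_sum,
    AddChar.sum_mulShift _ (AddChar.IsPrimitive.of_ne_one hχ)]
  split_ifs <;> simp [mul_comm]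

variable [CharP F 2]

theorem addChar_mul_self (χ : AddChar F ℤ) (s : F) : χ s * χ s = 1 := by
  rw [← AddChar.map_add_eq_mul, CharTwo.add_self_eq_zero, AddChar.map_zero_eq_one]

/-- Elements r² + r lie in the kernel of χ, so equalities of values of χ become polynomial
identities once r is supplied. -/
theorem addChar_eq_of_add (hsq : ∀ s, χ (s ^ 2) = χ s) {x y r : F} (h : x = y + (r ^ 2 + r)) :
    χ x = χ y := by
  rw [h, AddChar.map_add_eq_mul, AddChar.map_add_eq_mul, hsq, addChar_mul_self, mul_one]

theorem carryBent_eq (χ : AddChar F ℤ) (δ w : F) (y : CarryPair F) :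
    carryBent χ δ w y = 1 ∨ carryBent χ δ w y = -1 :=
  mul_self_eq_one_iff.mp (addChar_mul_self χ _)

theorem carryBent_inv (hsq : ∀ s, χ (s ^ 2) = χ s) {w : F} (hw : w ≠ 0) (y : CarryPair F) :
    carryBent χ δ w y⁻¹ = carryBent χ δ w y := by
  have h2 : (2 : F) = 0 := CharTwo.two_eq_zero
  obtain ⟨m, hm⟩ : ∃ m, y.fst = m * w := ⟨y.fst / w, by field_simp⟩
  apply addChar_eq_of_add hsq (r := m ^ 2)
  simp only [CarryPair.fst_inv, CarryPair.snd_inv, CharTwo.neg_eq, hm]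
  field_simp
  linear_combination (w ^ 2 * m ^ 3) * h2

theorem sum_carryBent [Fintype F] (hχ : χ ≠ 1) (hδ : χ δ = -1) {w : F} (hw : w ≠ 0) :
    ∑ y, carryBent χ δ w y = -Fintype.card F := by
  classical
  have h2 : (2 : F) = 0 := CharTwo.two_eq_zero
  rw [CarryPair.sum_eq]
  simp only [carryBent]
  rw [sum_addChar_mul_add hχ (fun u => u / w + (u / w) ^ 3 + δ * (u / w) ^ 2)
    (fun u => ((u / w + 1) / w) ^ 2)]
  have hiff (u : F) : ((u / w + 1) / w) ^ 2 = 0 ↔ u = w := by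
    rw [sq_eq_zero_iff, div_eq_zero_iff, or_iff_left hw, CharTwo.add_eq_zero, div_eq_one_iff_eq hw]
  simp only [hiff, Finset.sum_ite_eq', Finset.mem_univ, if_true, div_self hw]
  -- At the only surviving point u = w the phase is δ, which fixes the sign.
  rw [show (1 + 1 ^ 3 + δ * 1 ^ 2 : F) = δ by linear_combination h2, hδ]
  ring

theorem carryBent_mul_carryBent (χ : AddChar F ℤ) (δ w w' u v : F) (y : CarryPair F) :
    carryBent χ δ w (y * ⟨u, v⟩) * carryBent χ δ w' ⟨u, v⟩ =
      χ ((((y.fst + u) / w + ((y.fst + u) / w) ^ 3 + δ * ((y.fst + u) / w) ^ 2 +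
        (y.snd + y.fst * u) * (((y.fst + u) / w + 1) / w) ^ 2) +
        (u / w' + (u / w') ^ 3 + δ * (u / w') ^ 2)) +
        v * (((y.fst + u) / w + 1) / w + (u / w' + 1) / w') ^ 2) := by
  rw [carryBent, carryBent, ← AddChar.map_add_eq_mul, CharTwo.add_sq]
  simp only [CarryPair.fst_mul, CarryPair.snd_mul]
  congr 1
  ring

theorem sum_carryBent_mul_self [Fintype F] [DecidableEq F] (hχ : χ ≠ 1)
    (hsq : ∀ s, χ (s ^ 2) = χ s) {w : F} (hw : w ≠ 0)
    {y : CarryPair F} (hy : y ≠ 1) :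
    ∑ z, carryBent χ δ w (y * z) * carryBent χ δ w z = 0 := by
  have h2 : (2 : F) = 0 := CharTwo.two_eq_zero
  rw [CarryPair.sum_eq]
  simp only [carryBent_mul_carryBent]
  rw [sum_addChar_mul_add hχ (fun u => _) (fun u => _)]
  have hiff (u : F) : (((y.fst + u) / w + 1) / w + (u / w + 1) / w) ^ 2 = 0 ↔ y.fst = 0 := by
    have : ((y.fst + u) / w + 1) / w + (u / w + 1) / w = y.fst / w ^ 2 := by
      field_simp
      linear_combination (u + w) * h2
    rw [this]
    simp [hw]
  simp only [hiff]
  split_ifs with h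
  · have hv : y.snd ≠ 0 := fun h' => hy (by ext <;> simp [h, h'])
    have hterm (u : F) : ((y.fst + u) / w + ((y.fst + u) / w) ^ 3 + δ * ((y.fst + u) / w) ^ 2 +
        (y.snd + y.fst * u) * (((y.fst + u) / w + 1) / w) ^ 2) +
        (u / w + (u / w) ^ 3 + δ * (u / w) ^ 2) = y.snd * ((u / w + 1) / w) ^ 2 := by
      rw [h]
      linear_combination (u / w + (u / w) ^ 3 + δ * (u / w) ^ 2) * h2
    -- With `y.snd` = r² the whole phase is a square, and χ of it is χ of its root, which is affine
    -- in u.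
    obtain ⟨r, hr⟩ := FiniteField.isSquare_of_char_two (ringChar.eq F 2) y.snd
    have hlin (u : F) : χ (y.snd * ((u / w + 1) / w) ^ 2) = χ (r / w) * χ (u * (r / w ^ 2)) := by
      rw [← AddChar.map_add_eq_mul, ← hsq (r / w + _), hr]
      congr 1
      field_simp
      ring
    have hr0 : r / w ^ 2 ≠ 0 := div_ne_zero (by rintro rfl; simp [hr] at hv) (pow_ne_zero _ hw)
    simp only [hterm, hlin, ← Finset.mul_sum]
    rw [AddChar.sum_mulShift _ (AddChar.IsPrimitive.of_ne_one hχ), if_neg hr0]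
    simp
  · simp

theorem sum_carryBent_mul [Fintype F] [DecidableEq F] (hχ : χ ≠ 1) (hδ : χ δ = -1)
    (hsq : ∀ s, χ (s ^ 2) = χ s) {w w' : F} (hw : w ≠ 0) (hw' : w' ≠ 0) (hne : w + w' ≠ 0)
    (y : CarryPair F) :
    ∑ z, carryBent χ δ w (y * z) * carryBent χ δ w' z =
      -Fintype.card F * carryBent χ δ (w + w') y := by
  have h2 : (2 : F) = 0 := CharTwo.two_eq_zero
  rw [CarryPair.sum_eq]
  simp only [carryBent_mul_carryBent]
  rw [sum_addChar_mul_add hχ (fun u => _) (fun u => _)]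
  -- The high-digit coefficient of f_w at low digit w(1 + cw) is c². With this c, the three
  -- functions for w, w' and w + w' share one coefficient exactly at the surviving u.
  obtain ⟨c, hc⟩ : ∃ c, y.fst = (w + w') * (1 + c * (w + w')) :=
    ⟨(y.fst + (w + w')) / (w + w') ^ 2, by
      field_simp
      linear_combination (-w - w') * h2⟩
  have hiff (u : F) : (((y.fst + u) / w + 1) / w + (u / w' + 1) / w') ^ 2 = 0 ↔
      u = w' * (1 + c * w') := by
    rw [sq_eq_zero_iff]
    have : ((y.fst + u) / w + 1) / w + (u / w' + 1) / w' =
        ((w + w') / (w * w')) ^ 2 * (u - w' * (1 + c * w')) := by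
      rw [hc]
      field_simp
      grind
    rw [this, mul_eq_zero, or_iff_right (pow_ne_zero _ (div_ne_zero hne (mul_ne_zero hw hw'))),
      sub_eq_zero]
  simp only [hiff, Finset.sum_ite_eq', Finset.mem_univ, if_true]
  rw [neg_mul, ← mul_neg, ← neg_one_mul, ← hδ, carryBent, ← AddChar.map_add_eq_mul]
  congr 1
  have e1 : (y.fst + w' * (1 + c * w')) / w = 1 + c * w := by
    rw [hc]
    field_simp
    grind
  have e2 : w' * (1 + c * w') / w' = 1 + c * w' := by field_simp
  have e3 : y.fst / (w + w') = 1 + c * (w + w') := by rw [hc]; field_simp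
  have e4 : (1 + c * w + 1) / w = c := by
    field_simp
    linear_combination h2
  have e5 : (1 + c * (w + w') + 1) / (w + w') = c := by
    field_simp
    linear_combination h2
  rw [e1, e2, e3, e4, e5, hc]
  -- With a = cw and b = cw', the cubic terms leave a²b + ab². Adding the carry term gives r² + r
  -- for r = ab + b².
  apply addChar_eq_of_add hsq (r := c * w * (c * w') + (c * w') ^ 2)
  grind

end BentFamily

/-! ### Counting differences in the abelian group. -/

section PartialDifferenceSet

theorem ncard_mul_inv_eq {G : Type*} [Group G] (D : Set G) (g : G) :
    {p : G × G | p.1 ∈ D ∧ p.2 ∈ D ∧ p.1 * p.2⁻¹ = g}.ncard = {x | g * x ∈ D ∧ x ∈ D}.ncard := by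
  refine Set.ncard_congr (fun p _ => p.2) ?_ ?_ ?_
  · rintro p ⟨h1, h2, rfl⟩
    simpa using ⟨h1, h2⟩
  · rintro ⟨a, b⟩ ⟨c, d⟩ ⟨-, -, h⟩ ⟨-, -, h'⟩ rfl
    simpa [← h'] using h
  · rintro x ⟨h1, h2⟩
    exact ⟨(g * x, x), ⟨h1, h2, by simp⟩, rfl⟩

theorem Set.cast_ncard_eq_sum {α : Type*} [Fintype α] (s : Set α) [DecidablePred (· ∈ s)] :
    (s.ncard : ℤ) = ∑ x, if x ∈ s then 1 else 0 := by
  rw [Finset.sum_boole, Set.ncard_eq_toFinset_card', Set.toFinset_card, Fintype.card_subtype]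

variable {F : Type*} [Field F]

/-- The Denniston set attached to the family `carryBent`. -/
def carryDenniston (χ : AddChar F ℤ) (δ : F) : Set (CarryPair F × Multiplicative F) :=
  {g | g.2.toAdd ≠ 0 ∧ carryBent χ δ g.2.toAdd g.1 = 1}

/-- Twice the indicator function of `carryDenniston`. -/
def carryWeight [DecidableEq F] (χ : AddChar F ℤ) (δ x : F) (y : CarryPair F) : ℤ :=
  if x = 0 then 0 else 1 + carryBent χ δ x y

variable {χ : AddChar F ℤ} {δ : F} [CharP F 2]

theorem carryDenniston_inv (hsq : ∀ s, χ (s ^ 2) = χ s) {g : CarryPair F × Multiplicative F}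
    (hg : g ∈ carryDenniston χ δ) : g⁻¹ ∈ carryDenniston χ δ := by
  obtain ⟨h1, h2⟩ := hg
  refine ⟨by simpa using h1, ?_⟩
  simpa [CharTwo.neg_eq, carryBent_inv hsq h1] using h2

variable [DecidableEq F]

theorem carryWeight_eq (y : CarryPair F) (x : F) [Decidable ((y, .ofAdd x) ∈ carryDenniston χ δ)] :
    carryWeight χ δ x y = 2 * if (y, .ofAdd x) ∈ carryDenniston χ δ then 1 else 0 := by
  rcases carryBent_eq χ δ x y with h | h <;> by_cases hx : x = 0 <;>
    simp [carryWeight, carryDenniston, h, hx]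

variable [Fintype F]

theorem two_mul_ncard_carryDenniston :
    2 * ((carryDenniston χ δ).ncard : ℤ) = ∑ x, ∑ y, carryWeight χ δ x y := by
  classical
  rw [Set.cast_ncard_eq_sum, Fintype.sum_prod_type_right, ← Multiplicative.ofAdd.sum_comp]
  simp only [carryWeight_eq, Finset.mul_sum]

theorem four_mul_ncard_carryDenniston (y₀ : CarryPair F) (x₀ : F) :
    4 * ({g | (y₀, .ofAdd x₀) * g ∈ carryDenniston χ δ ∧ g ∈ carryDenniston χ δ}.ncard : ℤ) =
      ∑ x, ∑ y, carryWeight χ δ (x₀ + x) (y₀ * y) * carryWeight χ δ x y := by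
  classical
  rw [Set.cast_ncard_eq_sum, Fintype.sum_prod_type_right, ← Multiplicative.ofAdd.sum_comp]
  simp only [carryWeight_eq, Finset.mul_sum, Set.mem_ofPred_eq, Prod.mk_mul_mk, ← ofAdd_add, ite_and]
  refine Finset.sum_congr rfl fun x _ => Finset.sum_congr rfl fun y _ => ?_
  split_ifs <;> norm_num

theorem sum_carryWeight (hχ : χ ≠ 1) (hδ : χ δ = -1) {x : F} (hx : x ≠ 0) :
    ∑ y, carryWeight χ δ x y = (Fintype.card F : ℤ) ^ 2 - Fintype.card F := by
  have hcard : (Fintype.card (CarryPair F) : ℤ) = (Fintype.card F : ℤ) ^ 2 := by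
    simpa [← Nat.card_eq_fintype_card] using congrArg (Nat.cast (R := ℤ)) (CarryPair.card_eq F)
  simp [carryWeight, hx, Finset.sum_add_distrib, sum_carryBent hχ hδ hx, hcard, sub_eq_add_neg]

theorem sum_carryWeight_mul (hχ : χ ≠ 1) (hδ : χ δ = -1) {w w' : F} (hw : w ≠ 0) (hw' : w' ≠ 0)
    (y₀ : CarryPair F) :
    ∑ y, carryWeight χ δ w (y₀ * y) * carryWeight χ δ w' y = (Fintype.card F : ℤ) ^ 2 -
      2 * Fintype.card F + ∑ y, carryBent χ δ w (y₀ * y) * carryBent χ δ w' y := by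
  have hcard : (Fintype.card (CarryPair F) : ℤ) = (Fintype.card F : ℤ) ^ 2 := by
    simpa [← Nat.card_eq_fintype_card] using congrArg (Nat.cast (R := ℤ)) (CarryPair.card_eq F)
  have htrans : ∑ y, carryBent χ δ w (y₀ * y) = -Fintype.card F :=
    (Equiv.sum_comp (Equiv.mulLeft y₀) (carryBent χ δ w)).trans (sum_carryBent hχ hδ hw)
  simp only [carryWeight, hw, hw', if_false, add_mul, mul_add, one_mul, mul_one,
    Finset.sum_add_distrib, htrans, sum_carryBent hχ hδ hw']
  simp [hcard]
  ring

theorem card_filter_ne_zero_and_add_ne_zero {x₀ : F} (hx₀ : x₀ ≠ 0) :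
    ((Finset.univ.filter fun x : F => x ≠ 0 ∧ x₀ + x ≠ 0).card : ℤ) = Fintype.card F - 2 := by
  have : (Finset.univ.filter fun x : F => x ≠ 0 ∧ x₀ + x ≠ 0) = ({0, x₀} : Finset F)ᶜ := by
    ext x
    simp [CharTwo.add_eq_zero, eq_comm]
  rw [this, Finset.card_compl, Finset.card_pair hx₀.symm, Nat.cast_sub, Nat.cast_two]
  exact (Finset.card_pair hx₀.symm).symm.trans_le (Finset.card_le_univ _)

/-- The slices that meet have indices x₀ + x and x, whose sum is always x₀; each of the q - 2
admissible x contributes the same cross-correlation. -/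
theorem four_mul_ncard_of_ne_zero (hχ : χ ≠ 1) (hδ : χ δ = -1) (hsq : ∀ s, χ (s ^ 2) = χ s)
    (y₀ : CarryPair F) {x₀ : F} (hx₀ : x₀ ≠ 0) :
    4 * ({g | (y₀, .ofAdd x₀) * g ∈ carryDenniston χ δ ∧ g ∈ carryDenniston χ δ}.ncard : ℤ) =
      (Fintype.card F - 2) * ((Fintype.card F : ℤ) ^ 2 - 2 * Fintype.card F -
        Fintype.card F * carryBent χ δ x₀ y₀) := by
  rw [four_mul_ncard_carryDenniston, ← card_filter_ne_zero_and_add_ne_zero hx₀, ← nsmul_eq_mul,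
    ← Finset.sum_const, Finset.sum_filter]
  refine Finset.sum_congr rfl fun x _ => ?_
  split_ifs with h
  · have hsum : x₀ + x + x = x₀ := CharTwo.add_cancel_right x₀ x
    rw [sum_carryWeight_mul hχ hδ h.2 h.1, sum_carryBent_mul hχ hδ hsq h.2 h.1 (by rwa [hsum]),
      hsum]
    ring
  · refine Finset.sum_eq_zero fun y _ => ?_
    by_cases hx : x = 0
    · simp [carryWeight, hx]
    · simp [carryWeight, show x₀ + x = 0 by tauto]

/-- Only autocorrelations occur, and they vanish. The value agrees with that of the previous lemma
at `carryBent` = -1, giving a single μ. -/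
theorem four_mul_ncard_of_ne_one (hχ : χ ≠ 1) (hδ : χ δ = -1) (hsq : ∀ s, χ (s ^ 2) = χ s)
    {y₀ : CarryPair F} (hy₀ : y₀ ≠ 1) :
    4 * ({g | (y₀, .ofAdd 0) * g ∈ carryDenniston χ δ ∧ g ∈ carryDenniston χ δ}.ncard : ℤ) =
      (Fintype.card F - 1) * ((Fintype.card F : ℤ) ^ 2 - 2 * Fintype.card F) := by
  have hcard : (Finset.univ.filter fun x : F => x ≠ 0).card = Fintype.card F - (1 : ℤ) := by
    rw [Finset.filter_ne', Finset.cast_card_erase_of_mem (Finset.mem_univ _), Finset.card_univ]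
  rw [four_mul_ncard_carryDenniston, ← hcard, ← nsmul_eq_mul, ← Finset.sum_const,
    Finset.sum_filter]
  refine Finset.sum_congr rfl fun x _ => ?_
  rw [zero_add]
  split_ifs with h
  · rw [sum_carryWeight_mul hχ hδ h h, sum_carryBent_mul_self hχ hsq h hy₀, add_zero]
  · simp [carryWeight, not_not.mp h]

theorem ncard_carryDenniston (hχ : χ ≠ 1) (hδ : χ δ = -1) :
    2 * ((carryDenniston χ δ).ncard : ℤ) =
      (Fintype.card F - 1) * ((Fintype.card F : ℤ) ^ 2 - Fintype.card F) := by
  have hcard : (Finset.univ.filter fun x : F => x ≠ 0).card = Fintype.card F - (1 : ℤ) := by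
    rw [Finset.filter_ne', Finset.cast_card_erase_of_mem (Finset.mem_univ _), Finset.card_univ]
  rw [two_mul_ncard_carryDenniston, ← hcard, ← nsmul_eq_mul, ← Finset.sum_const,
    Finset.sum_filter]
  refine Finset.sum_congr rfl fun x _ => ?_
  split_ifs with h
  · exact sum_carryWeight hχ hδ h
  · simp [carryWeight, not_not.mp h]

theorem isPartialDifferenceSet_carryDenniston (hχ : χ ≠ 1) (hδ : χ δ = -1)
    (hsq : ∀ s, χ (s ^ 2) = χ s) {t : ℕ} (ht : 2 ≤ t) (hF : Fintype.card F = 2 ^ t) :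
    IsPartialDifferenceSet (carryDenniston χ δ)
      (2 ^ (3 * t))
      ((2 ^ (2 * t - 1) - 2 ^ (t - 1)) * (2 ^ t - 1))
      (2 ^ (t - 1) + (2 ^ (2 * t - 1) - 2 ^ (t - 1)) * (2 ^ (t - 1) - 2))
      ((2 ^ (2 * t - 1) - 2 ^ (t - 1)) * (2 ^ (t - 1) - 1)) := by
  obtain ⟨s, rfl⟩ := Nat.exists_eq_add_of_le' ht
  -- Writing 2^(t-1) = r + 2, possible since t ≥ 2, makes all truncated subtractions exact.
  obtain ⟨r, hr⟩ : ∃ r, 2 ^ (s + 1) = r + 2 :=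
    Nat.exists_eq_add_of_le' (le_self_pow₀ one_le_two s.succ_ne_zero)
  have e1 : 2 ^ (s + 2) = 2 * (r + 2) := by rw [← hr]; ring
  have e2 : 2 ^ (2 * (s + 2) - 1) - (r + 2) = (r + 2) * (2 * r + 3) := by
    have : 2 ^ (2 * (s + 2) - 1) = (r + 2) * (2 * r + 3) + (r + 2) := by
      rw [show 2 * (s + 2) - 1 = 2 * (s + 1) + 1 by omega, pow_succ, pow_mul', hr]
      ring
    omega
  have e3 : 2 ^ (s + 2) - 1 = 2 * r + 3 := by omega
  have hq : (Fintype.card F : ℤ) = 2 * (r + 2) := by rw [hF, e1]; push_cast; ring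
  rw [show s + 2 - 1 = s + 1 by omega, hr, e2, e3, Nat.add_sub_cancel,
    show r + 2 - 1 = r + 1 by omega]
  refine ⟨inferInstance, ?_, ?_, ?_, ?_⟩
  · rw [Nat.card_prod, CarryPair.card_eq, Nat.card_congr Multiplicative.toAdd,
      Nat.card_eq_fintype_card, hF]
    ring
  · have := ncard_carryDenniston hχ hδ
    rw [hq] at this
    zify
    linarith
  · rintro ⟨y, x⟩ hg
    have := four_mul_ncard_of_ne_zero hχ hδ hsq y hg.1
    rw [hq, hg.2] at this
    rw [ncard_mul_inv_eq]
    zify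
    linarith!
  · rintro ⟨y, x⟩ hg hg1
    rw [ncard_mul_inv_eq]
    zify
    by_cases hx : x.toAdd = 0
    · have := four_mul_ncard_of_ne_one hχ hδ hsq (y₀ := y) (by
        rintro rfl
        exact hg1 (Prod.ext rfl hx))
      rw [hq] at this
      obtain rfl : x = .ofAdd 0 := hx
      linarith
    · have := four_mul_ncard_of_ne_zero hχ hδ hsq y hx
      rw [hq, (carryBent_eq χ δ x.toAdd y).resolve_left fun h => hg ⟨hx, h⟩] at this
      linarith!

end PartialDifferenceSet

/-! ### Transport along twisted bijections. -/

section Transport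

variable {G H : Type*} [Group G] [Group H] {v k l m : ℕ}

/-- A bijection that is multiplicative up to permutations preserving `S` pulls `S` back to a
partial difference set with the same parameters. -/
theorem IsPartialDifferenceSet.preimage {S : Set H} (hS : IsPartialDifferenceSet S v k l m)
    (e : G ≃ H) (he : e 1 = 1) (hmul : ∀ g : G, ∃ σ : H ≃ H, σ ⁻¹' S = S ∧
      ∀ x, e (g * x) = e g * σ (e x)) :
    IsPartialDifferenceSet (e ⁻¹' S) v k l m := by
  have hcount (g : G) : {p : G × G | p.1 ∈ e ⁻¹' S ∧ p.2 ∈ e ⁻¹' S ∧ p.1 * p.2⁻¹ = g}.ncard =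
      {p : H × H | p.1 ∈ S ∧ p.2 ∈ S ∧ p.1 * p.2⁻¹ = e g}.ncard := by
    obtain ⟨σ, hσ, hg⟩ := hmul g
    rw [ncard_mul_inv_eq, ncard_mul_inv_eq,
      ← Set.ncard_preimage_of_injective_subset_range (e.trans σ).injective
        (by rw [(e.trans σ).range_eq_univ]; exact Set.subset_univ _)]
    congr 1
    ext x
    have hx : σ (e x) ∈ S ↔ e x ∈ S := by rw [← Set.mem_preimage, hσ]
    simp [hg, hx]
  have := hS.finite
  refine ⟨Finite.of_equiv H e.symm, (Nat.card_congr e).trans hS.card_group, ?_, ?_, ?_⟩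
  · rw [Set.ncard_preimage_of_injective_subset_range e.injective
      (by rw [e.range_eq_univ]; exact Set.subset_univ _), hS.card_set]
  · exact fun g hg => (hcount g).trans (hS.card_mem _ hg)
  · exact fun g hg h1 => (hcount g).trans (hS.card_notMem _ hg (by rwa [← he, e.injective.ne_iff]))

theorem IsPartialDifferenceSet.preimage_mulEquiv {S : Set H}
    (hS : IsPartialDifferenceSet S v k l m) (e : G ≃* H) :
    IsPartialDifferenceSet (e ⁻¹' S) v k l m :=
  hS.preimage e.toEquiv (map_one e) fun g => ⟨Equiv.refl H, rfl, map_mul e g⟩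

end Transport

/-! ### Twisting by inversion. -/

section Semidirect

variable {A B : Type*} [CommGroup A] [CommGroup B] {v k l m : ℕ}

/-- Left multiplication by g in A ⋊ B is that of A × B preceded by φ(g.right) on A, a symmetry of S.
-/
theorem IsPartialDifferenceSet.semidirectProduct {S : Set (A × B)}
    (hS : IsPartialDifferenceSet S v k l m) (φ : B →* MulAut A)
    (hφ : ∀ b, ∀ x : A × B, (φ b x.1, x.2) ∈ S ↔ x ∈ S) :
    IsPartialDifferenceSet
      ((SemidirectProduct.equivProd : A ⋊[φ] B ≃ A × B) ⁻¹' S) v k l m := by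
  refine hS.preimage _ rfl fun g =>
    ⟨Equiv.prodCongr (φ g.right).toEquiv (Equiv.refl B), ?_, fun x => rfl⟩
  ext x
  exact hφ g.right x

/-- The action of the cyclic group of order two on an abelian group by inversion. -/
def invAction (A : Type*) [CommGroup A] : Multiplicative (ZMod 2) →* MulAut A where
  toFun z := if z.toAdd = 0 then 1 else MulEquiv.inv A
  map_one' := by simp
  map_mul' x y := by
    have h (z : ZMod 2) : z = 0 ∨ z = 1 := by revert z; decide
    have h11 : (1 + 1 : ZMod 2) = 0 := rfl
    rcases h x.toAdd with hx | hx <;> rcases h y.toAdd with hy | hy <;>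
      simp [hx, hy, h11]
    ext
    simp

theorem invAction_apply (z : Multiplicative (ZMod 2)) (a : A) :
    invAction A z a = a ∨ invAction A z a = a⁻¹ := by
  change (if z.toAdd = 0 then 1 else MulEquiv.inv A) a = a ∨
    (if z.toAdd = 0 then 1 else MulEquiv.inv A) a = a⁻¹
  split_ifs
  · exact .inl rfl
  · exact .inr rfl

theorem invAction_ofAdd_one (a : A) : invAction A (.ofAdd 1) a = a⁻¹ := by
  simp [invAction]

theorem exists_semidirectProduct {r : ℕ} (hr : 1 ≤ r) {S : Set (A × Cpow 2 r)}
    (hS : IsPartialDifferenceSet S v k l m) (hinv : ∀ x ∈ S, x⁻¹ ∈ S) (hA : ∃ a : A, a⁻¹ ≠ a) :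
    ∃ φ : Cpow 2 r →* MulAut A, (¬ ∀ x y : A ⋊[φ] Cpow 2 r, x * y = y * x) ∧
      ∃ D : Set (A ⋊[φ] Cpow 2 r), IsPartialDifferenceSet D v k l m := by
  -- Only coordinate 0 acts, which is where r ≥ 1 is needed.
  let φ : Cpow 2 r →* MulAut A := (invAction A).comp (Pi.evalMonoidHom _ ⟨0, hr⟩)
  refine ⟨φ, fun hcomm => ?_, _, hS.semidirectProduct φ ?_⟩
  · obtain ⟨a, ha⟩ := hA
    have := congrArg SemidirectProduct.left
      (hcomm (SemidirectProduct.inr fun _ => .ofAdd 1) (SemidirectProduct.inl a))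
    simp [φ, invAction_ofAdd_one] at this
    exact ha this
  · have hB (b : Cpow 2 r) : b⁻¹ = b := funext fun i => by
      have h (z : Multiplicative (ZMod 2)) : z⁻¹ = z := by revert z; decide
      exact h (b i)
    have hiff (x : A × Cpow 2 r) : (x.1⁻¹, x.2) ∈ S ↔ x ∈ S := by
      rw [← hB x.2]
      refine ⟨fun h => ?_, fun h => ?_⟩
      · simpa [hB] using hinv _ h
      · exact hinv x h
    intro b x
    rcases invAction_apply (b ⟨0, hr⟩) x.1 with h | h
    · rw [show φ b x.1 = x.1 from h]
    · rw [show φ b x.1 = x.1⁻¹ from h, hiff]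

end Semidirect

/-! ### Identifying the groups and the character. -/

section Isomorphisms

variable {F : Type*} [Field F] [Fintype F] [Algebra (ZMod 2) F] {t : ℕ}

/-- Lifts of a basis generate: their products reach every low digit, and (r, v)² = (0, r²) reaches
every high digit because squaring is onto. Equal cardinalities then give bijectivity. -/
theorem nonempty_mulEquiv_carryPair (hF : Module.finrank (ZMod 2) F = t) :
    Nonempty (Cpow 4 t ≃* CarryPair F) := by
  have : CharP F 2 := (Algebra.charP_iff (ZMod 2) F 2).mp inferInstance
  have h2 : (2 : F) = 0 := CharTwo.two_eq_zero
  let b := Module.finBasisOfFinrankEq (ZMod 2) F hF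
  have hfour (y : CarryPair F) : y ^ 4 = 1 := by
    ext <;> simp [pow_succ]
    · linear_combination (2 * y.fst) * h2
    · linear_combination (2 * y.snd + 3 * y.fst ^ 2) * h2
  have hker (y : CarryPair F) :
      zmultiplesHom _ (Additive.ofMul y) ((4 : ℕ) : ℤ) = 0 := by
    rw [zmultiplesHom_apply, natCast_zsmul, ← ofMul_pow, hfour, ofMul_one]
  let ψ (y : CarryPair F) : Multiplicative (ZMod 4) →* CarryPair F :=
    AddMonoidHom.toMultiplicativeLeft (ZMod.lift 4 ⟨zmultiplesHom _ (Additive.ofMul y), hker y⟩)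
  have hψ (y : CarryPair F) : ψ y (.ofAdd 1) = y := by
    have := ZMod.lift_coe 4 (A := Additive (CarryPair F)) ⟨zmultiplesHom _ (Additive.ofMul y), hker y⟩ 1
    simpa [ψ] using congrArg Additive.toMul this
  let Ψ : Cpow 4 t →* CarryPair F := ∏ i, (ψ ⟨b i, 0⟩).comp (Pi.evalMonoidHom _ i)
  have hgen (i : Fin t) : (⟨b i, 0⟩ : CarryPair F) ∈ Ψ.range :=
    ⟨Pi.mulSingle i (.ofAdd 1), by
      rw [MonoidHom.finsetProd_apply, Finset.prod_eq_single i]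
      · simp [hψ]
      · intro j _ hj
        simp [hj]
      · simp⟩
  have hfst (s : F) : ∃ v, (⟨s, v⟩ : CarryPair F) ∈ Ψ.range := by
    have hs : s ∈ Submodule.span (ZMod 2) (Set.range b) := by simp
    induction hs using Submodule.span_induction with
    | mem x hx =>
      obtain ⟨i, rfl⟩ := hx
      exact ⟨0, hgen i⟩
    | zero => exact ⟨0, one_mem _⟩
    | add x y _ _ hx hy =>
      obtain ⟨v, hv⟩ := hx
      obtain ⟨v', hv'⟩ := hy
      exact ⟨_, mul_mem hv hv'⟩
    | smul a x _ hx =>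
      have ha : a = 0 ∨ a = 1 := by
        revert a
        decide
      rcases ha with rfl | rfl
      · rw [zero_smul]
        exact ⟨0, one_mem _⟩
      · rwa [one_smul]
  have hsnd (s : F) : (⟨0, s⟩ : CarryPair F) ∈ Ψ.range := by
    obtain ⟨r, rfl⟩ := FiniteField.isSquare_of_char_two (ringChar.eq F 2) s
    obtain ⟨v, hv⟩ := hfst r
    convert mul_mem hv hv using 1
    ext <;> simp [CharTwo.add_self_eq_zero]
  have hsurj : Function.Surjective Ψ := by
    rw [← MonoidHom.range_eq_top, eq_top_iff]
    rintro ⟨u, v⟩ -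
    obtain ⟨v', hv'⟩ := hfst u
    convert mul_mem hv' (hsnd (v - v')) using 1
    ext <;> simp
  refine ⟨MulEquiv.ofBijective Ψ ((Nat.bijective_iff_surjective_and_card Ψ).mpr ⟨hsurj, ?_⟩)⟩
  rw [CarryPair.card_eq, Nat.card_fun, Nat.card_congr Multiplicative.toAdd, Nat.card_zmod,
    Nat.card_fin, Module.natCard_eq_pow_finrank (K := ZMod 2), hF, Nat.card_zmod, ← pow_mul,
    mul_comm, pow_mul]
  rfl

theorem nonempty_mulEquiv_cpow_two {k : ℕ} (hF : Module.finrank (ZMod 2) F = t) (hk : k ≤ t) :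
    Nonempty (Cpow 2 (t - k) × Cpow 2 k ≃* Multiplicative F) := by
  let e : ((Fin (t - k) → ZMod 2) × (Fin k → ZMod 2)) ≃ₗ[ZMod 2] F :=
    LinearEquiv.ofFinrankEq _ _ (by simp [hF, hk])
  exact ⟨((MulEquiv.piMultiplicative _).symm.prodCongr (MulEquiv.piMultiplicative _).symm).trans
    ((MulEquiv.prodMultiplicative _ _).symm.trans (AddEquiv.toMultiplicative e.toAddEquiv))⟩

/-- Take χ = (-1)^Tr: the trace is surjective and Frobenius-invariant. -/
theorem exists_trace_addChar :
    ∃ χ : AddChar F ℤ, ∃ δ, χ ≠ 1 ∧ χ δ = -1 ∧ ∀ s, χ (s ^ 2) = χ s := by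
  have : CharP F 2 := (Algebra.charP_iff (ZMod 2) F 2).mp inferInstance
  let χ : AddChar F ℤ := (AddChar.zmodChar 2 (ζ := (-1 : ℤ)) rfl).compAddMonoidHom
    (Algebra.trace (ZMod 2) F).toAddMonoidHom
  obtain ⟨δ, hδ⟩ := Algebra.trace_surjective (ZMod 2) F 1
  have hχδ : χ δ = -1 := by
    simp [χ, hδ, AddChar.zmodChar_apply]
    rfl
  refine ⟨χ, δ, fun h => ?_, hχδ, fun s => ?_⟩
  · rw [h] at hχδ
    norm_num at hχδ
  · have := Algebra.trace_eq_of_algEquiv (FiniteField.frobeniusAlgEquiv (ZMod 2) F 2) s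
    have hs : FiniteField.frobeniusAlgEquiv (ZMod 2) F 2 s = s ^ 2 := by simp
    rw [hs] at this
    simp [χ, this]

end Isomorphisms

theorem theorem6p5 (t k : ℕ) (ht : 2 ≤ t) (hk : 1 ≤ k) (hkt : k ≤ t) :
    ∃ (𝒢 : Type) (_ : Group 𝒢),
      (∃ φ : Cpow 2 k →* MulAut (Cpow 4 t × Cpow 2 (t - k)),
        Nonempty (𝒢 ≃* (Cpow 4 t × Cpow 2 (t - k)) ⋊[φ] Cpow 2 k)) ∧
      (¬ ∀ a b : 𝒢, a * b = b * a) ∧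
      ∃ D : Set 𝒢, IsPartialDifferenceSet D
        (2 ^ (3 * t))
        ((2 ^ (2 * t - 1) - 2 ^ (t - 1)) * (2 ^ t - 1))
        (2 ^ (t - 1) + (2 ^ (2 * t - 1) - 2 ^ (t - 1)) * (2 ^ (t - 1) - 2))
        ((2 ^ (2 * t - 1) - 2 ^ (t - 1)) * (2 ^ (t - 1) - 1)) := by
  classical
  let F := GaloisField 2 t
  have := Fintype.ofFinite F
  have ht0 : t ≠ 0 := by omega
  have hF : Module.finrank (ZMod 2) F = t := GaloisField.finrank 2 ht0
  have hcard : Fintype.card F = 2 ^ t := by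
    rw [← Nat.card_eq_fintype_card]
    exact GaloisField.card 2 t ht0
  obtain ⟨χ, δ, hχ, hδ, hsq⟩ := exists_trace_addChar (F := F)
  obtain ⟨e₁⟩ := nonempty_mulEquiv_carryPair hF
  obtain ⟨e₂⟩ := nonempty_mulEquiv_cpow_two hF hkt
  let e : (Cpow 4 t × Cpow 2 (t - k)) × Cpow 2 k ≃* CarryPair F × Multiplicative F :=
    MulEquiv.prodAssoc.trans (e₁.prodCongr e₂)
  have hpds := (isPartialDifferenceSet_carryDenniston hχ hδ hsq ht hcard).preimage_mulEquiv e
  obtain ⟨φ, hφ, hD⟩ := exists_semidirectProduct hk hpds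
    (fun x hx => by simpa only [Set.mem_preimage, map_inv] using carryDenniston_inv hsq hx)
    ⟨(fun _ => .ofAdd 1, 1), fun h => by
      have h0 : (Multiplicative.ofAdd (1 : ZMod 4))⁻¹ = .ofAdd 1 :=
        congrFun (congrArg Prod.fst h) ⟨0, by omega⟩
      exact absurd h0 (by decide)⟩
  exact ⟨_, inferInstance, ⟨φ, ⟨MulEquiv.refl _⟩⟩, hφ, hD⟩
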